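/- All graphs are finite and simple. For $n\ge 5$ let $B_n$ (the bicycle wheel) be the graph on $n$ vertices consisting of a rim cycle $1,2,\dots,n-2$ and two further adjacent vertices, called middle vertices, each joined to every rim vertex; the edges from the rim vertex $i$ to the first and to the second middle vertex are denoted $s_i$ and $t_i$. For even $n\ge 6$ let $A_n$ be the graph obtained from $B_n$ by deleting the edges $s_i$ with $i$ even and the edges $t_i$ with $i$ odd. A deletion-minor of a graph is a graph obtained from it by deleting a (possibly empty) set of edges, keeping all vertices. A $\mathcal B$ graph is a graph that is isomorphic to a non-planar $3$-connected deletion-minor of some bicycle wheel $B_m$, $m\ge 5$. A graph on $n$ vertices is pancyclic if it contains a cycle of length $k$ for every $3\le k\le n$. \textbf{Theorem.} Let $n\ge 5$ and let $G$ be a $\mathcal B$ graph on $n$ vertices. Unless $n$ is even and $G\cong A_n$, the graph $G$ is pancyclic. -/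

import Mathlib

namespace SimpleGraph

/-- A plane representation of a graph: distinct vertices are distinct points of the plane, the edge
`s(u, v)` is drawn as a simple arc between the points of `u` and `v`, no arc passes through a vertex
other than its ends, and two different arcs meet at most in a common end vertex. -/
structure PlaneRepresentation {V : Type*} (G : SimpleGraph V) where
  /-- the points that represent the vertices -/
  pos : V → ℝ × ℝ
  /-- the point sets that represent the edges (values off the edge set are irrelevant) -/
  arc : Sym2 V → Set (ℝ × ℝ)
  pos_injective : Function.Injective pos
  arc_simple : ∀ u v : V, G.Adj u v →
    ∃ γ : _root_.Path (pos u) (pos v), Function.Injective γ ∧ Set.range γ = arc s(u, v)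
  arc_vertex : ∀ e ∈ G.edgeSet, ∀ w : V, pos w ∈ arc e → w ∈ e
  arc_inter : ∀ e ∈ G.edgeSet, ∀ f ∈ G.edgeSet, e ≠ f →
    ∀ x ∈ arc e ∩ arc f, ∃ w : V, w ∈ e ∧ w ∈ f ∧ x = pos w

/-- A graph is planar if it can be drawn in the plane with no two edges crossing. -/
def IsPlanar {V : Type*} (G : SimpleGraph V) : Prop :=
  Nonempty G.PlaneRepresentation

/-- A vertex-cut: a set of vertices whose removal disconnects the graph or leaves at most one
vertex. -/
def IsVertexCut {V : Type*} (G : SimpleGraph V) (S : Set V) : Prop :=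
  ¬ (G.induce Sᶜ).Preconnected ∨ Sᶜ.Subsingleton

/-- A (finite) graph is `k`-connected if it has at least `k + 1` vertices and no vertex-cut of size
less than `k`. -/
def IsKConnected {V : Type*} (G : SimpleGraph V) (k : ℕ) : Prop :=
  k + 1 ≤ Nat.card V ∧ ∀ S : Finset V, S.card < k → ¬ G.IsVertexCut (S : Set V)

/-- A graph on `n` vertices is pancyclic if it has a cycle of every length from `3` to `n`. -/
def IsPancyclic {V : Type*} (G : SimpleGraph V) : Prop :=
  ∀ k : ℕ, 3 ≤ k → k ≤ Nat.card V → ∃ (v : V) (p : G.Walk v v), p.IsCycle ∧ p.length = k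

/-- `G` is, up to isomorphism, obtained from `H` by deleting a (possibly empty) set of edges. -/
def IsDeletionMinor {V W : Type*} (G : SimpleGraph V) (H : SimpleGraph W) : Prop :=
  ∃ E : Set (Sym2 W), Nonempty (G ≃g H.deleteEdges E)

/-- Adjacency in the bicycle wheel. `Sum.inl i` is the `(i + 1)`-st rim vertex, `Sum.inr false` and
`Sum.inr true` are the two middle vertices, incident to the `s`-spokes and the `t`-spokes. -/
def bicycleWheelAdj (n : ℕ) : Fin (n - 2) ⊕ Bool → Fin (n - 2) ⊕ Bool → Prop
  | .inl i, .inl j => (cycleGraph (n - 2)).Adj i j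
  | .inl _, .inr _ => True
  | .inr _, .inl _ => True
  | .inr a, .inr b => a ≠ b

/-- The bicycle wheel `B_n` (meant for `n ≥ 5`): a rim cycle on `n - 2` vertices and two adjacent
middle vertices, both joined to every rim vertex. -/
def bicycleWheel (n : ℕ) : SimpleGraph (Fin (n - 2) ⊕ Bool) where
  Adj := bicycleWheelAdj n
  symm := ⟨by
    rintro (i | a) (j | b) h
    · exact (cycleGraph (n - 2)).adj_symm h
    · trivial
    · trivial
    · exact Ne.symm h⟩
  loopless := ⟨by
    rintro (i | a) h
    · exact (cycleGraph (n - 2)).irrefl h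
    · exact h rfl⟩

/-- The spokes of `B_n` that are missing in `A_n`: with the rim labelled `1, …, n - 2`, these are
the `s`-spokes with even label and the `t`-spokes with odd label. -/
def alternatingMissingSpokes (n : ℕ) : Set (Sym2 (Fin (n - 2) ⊕ Bool)) :=
  {e | ∃ i : Fin (n - 2),
    (Even (i.val + 1) ∧ e = s(Sum.inl i, Sum.inr false)) ∨
    (Odd (i.val + 1) ∧ e = s(Sum.inl i, Sum.inr true))}

/-- The graph `A_n`: the bicycle wheel in which, going around the rim, `s`-spokes and `t`-spokes
alternate. -/
def alternatingBicycleWheel (n : ℕ) : SimpleGraph (Fin (n - 2) ⊕ Bool) :=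
  (bicycleWheel n).deleteEdges (alternatingMissingSpokes n)

/-- A `𝓑` graph: a non-planar `3`-connected deletion-minor of a bicycle wheel `B_m`, `m ≥ 5`. -/
def IsBGraph {V : Type*} (G : SimpleGraph V) : Prop :=
  (∃ m : ℕ, 5 ≤ m ∧ G.IsDeletionMinor (bicycleWheel m)) ∧ ¬ G.IsPlanar ∧ G.IsKConnected 3

end SimpleGraph

namespace SimpleGraph

/-! The bicycle wheel has a straight-line drawing whose only crossing is between one rim edge, which
may be any, and the middle edge. A non-planar deletion-minor therefore keeps the whole rim and the
middle edge, and lacks only spokes. By 3-connectedness every vertex meets a spoke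
(`IsBGraph.exists_coordinates`).

To find a cycle of length `d + 3`, close a rim path of `d` edges through both middle vertices, or
one of `d + 1` edges through a single middle vertex. If the first never works, spoke types are
invariant under rotation by `d`; if the second fails too, neighbouring rim vertices never share a
type. The spokes then alternate, so the rim is even and the graph is `A_n`. -/

/-- A graph is planar if it has a straight-line drawing in which no edge passes through a further
vertex and the interiors of different edges are disjoint. -/
theorem isPlanar_of_openSegment {V : Type*} {G : SimpleGraph V} (pos : V → ℝ × ℝ)
    (hpos : Function.Injective pos)
    (hvertex : ∀ u v w, G.Adj u v → pos w ∉ openSegment ℝ (pos u) (pos v))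
    (hinter : ∀ u v u' v', G.Adj u v → G.Adj u' v' → ∀ x ∈ openSegment ℝ (pos u) (pos v),
      x ∈ openSegment ℝ (pos u') (pos v') → s(u, v) = s(u', v')) : G.IsPlanar := by
  have hcases : ∀ u v : V, ∀ x ∈ segment ℝ (pos u) (pos v),
      x ∈ openSegment ℝ (pos u) (pos v) ∨ ∃ w, w ∈ s(u, v) ∧ x = pos w := by
    intro u v x hx
    rw [← insert_endpoints_openSegment] at hx
    rcases hx with rfl | rfl | hx
    · exact Or.inr ⟨u, by simp, rfl⟩
    · exact Or.inr ⟨v, by simp, rfl⟩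
    · exact Or.inl hx
  let arc : Sym2 V → Set (ℝ × ℝ) :=
    Sym2.lift ⟨fun u v => segment ℝ (pos u) (pos v), fun u v => segment_symm ℝ _ _⟩
  have hav : ∀ e ∈ G.edgeSet, ∀ w : V, pos w ∈ arc e → w ∈ e := by
    intro e he w hw
    induction e with
    | _ u v =>
      rcases hcases u v _ hw with h | ⟨w', hw', h⟩
      · exact absurd h (hvertex u v w he)
      · exact hpos h ▸ hw'
  refine ⟨⟨pos, arc, hpos, ?_, hav, ?_⟩⟩
  · intro u v huv
    have hne : pos u ≠ pos v := fun h => huv.ne (hpos h)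
    refine ⟨⟨⟨fun t => AffineMap.lineMap (pos u) (pos v) (t : ℝ), by fun_prop⟩, by simp, by simp⟩,
      ?_, ?_⟩
    · intro s t hst
      exact Subtype.ext (AffineMap.lineMap_injective ℝ hne hst)
    · change _ = segment ℝ (pos u) (pos v)
      rw [segment_eq_image_lineMap]
      ext x
      simp only [Set.mem_range, Set.mem_image]
      constructor
      · rintro ⟨t, rfl⟩
        exact ⟨t, t.2, rfl⟩
      · rintro ⟨t, ht, rfl⟩
        exact ⟨⟨t, ht⟩, rfl⟩
  · intro e he f hf hne x hx
    have key : ∃ w : V, x = pos w := by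
      induction e with
      | _ u v =>
      induction f with
      | _ u' v' =>
        rcases hcases u v x hx.1 with h | ⟨w, -, h⟩
        · rcases hcases u' v' x hx.2 with h' | ⟨w, -, h'⟩
          · exact absurd (hinter u v u' v' he hf x h h') hne
          · exact ⟨w, h'⟩
        · exact ⟨w, h⟩
    obtain ⟨w, rfl⟩ := key
    exact ⟨w, hav e he w hx.1, hav f hf w hx.2, rfl⟩

/-! ### Drawing the wheel with a single crossing -/

/-- Edges, each with one orientation, of the bicycle wheel with rim `0, 1, …, R`; rim vertices are
labelled by natural numbers. -/
inductive WheelEdge (R : ℕ) : ℕ ⊕ Bool → ℕ ⊕ Bool → Prop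
  | rim (i : ℕ) (h1 : 1 ≤ i) (h2 : i < R) : WheelEdge R (.inl i) (.inl (i + 1))
  | first : WheelEdge R (.inl 0) (.inl 1)
  | last : WheelEdge R (.inl 0) (.inl R)
  | spokeFalse (i : ℕ) (h1 : 1 ≤ i) (h2 : i ≤ R) : WheelEdge R (.inl i) (.inr false)
  | spokeTrue (i : ℕ) (h1 : 1 ≤ i) (h2 : i ≤ R) : WheelEdge R (.inl i) (.inr true)
  | zeroFalse : WheelEdge R (.inl 0) (.inr false)
  | zeroTrue : WheelEdge R (.inl 0) (.inr true)
  | mid : WheelEdge R (.inr false) (.inr true)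

/-- The vertex positions of a straight-line drawing of the bicycle wheel in which the only crossing
is that of the rim edge from `0` to `1` with the edge between the middle vertices. -/
noncomputable def wheelPos : ℕ ⊕ Bool → ℝ × ℝ
  -- A height strictly between -2 and -3/2 makes the edge to `(1, 0)` pass above `(0, -1)` and the
  -- edge to `(R, 0)` below it, for every `R ≥ 2`.
  | .inl 0 => (-1, -7 / 4)
  | .inl (i + 1) => (i + 1, 0)
  | .inr false => (0, 1)
  | .inr true => (0, -1)

theorem wheelPos_inl {i : ℕ} (hi : 1 ≤ i) : wheelPos (.inl i) = ((i : ℝ), 0) := by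
  obtain ⟨j, rfl⟩ := Nat.exists_eq_add_of_le' hi
  simp [wheelPos]

theorem wheelPos_injective : Function.Injective wheelPos := by
  rintro ((_ | i) | (_ | _)) ((_ | j) | (_ | _)) h <;>
    simp only [wheelPos, Prod.mk.injEq] at h <;>
    first
    | rfl
    | (exfalso; norm_num at h; done)
    | (have hij : i = j := by exact_mod_cast add_right_cancel h.1
       rw [hij])

/-- The line through, and the coordinate range of, the interior of each edge in the drawing. -/
def OnWheelEdge (R : ℕ) (u v : ℕ ⊕ Bool) (X Y : ℝ) : Prop :=
  (∃ i : ℕ, 1 ≤ i ∧ i < R ∧ u = .inl i ∧ v = .inl (i + 1) ∧ Y = 0 ∧ i < X ∧ X < i + 1) ∨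
  (u = .inl 0 ∧ v = .inl 1 ∧ 8 * Y = 7 * (X - 1) ∧ -1 < X ∧ X < 1) ∨
  (u = .inl 0 ∧ v = .inl R ∧ 4 * (R + 1) * Y = 7 * (X - R) ∧ -1 < X ∧ X < R) ∨
  (∃ i : ℕ, 1 ≤ i ∧ i ≤ R ∧ u = .inl i ∧ v = .inr false ∧ X = i * (1 - Y) ∧ 0 < Y ∧ Y < 1) ∨
  (∃ i : ℕ, 1 ≤ i ∧ i ≤ R ∧ u = .inl i ∧ v = .inr true ∧ X = i * (1 + Y) ∧ -1 < Y ∧ Y < 0) ∨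
  (u = .inl 0 ∧ v = .inr false ∧ 4 * Y = 4 + 11 * X ∧ -1 < X ∧ X < 0) ∨
  (u = .inl 0 ∧ v = .inr true ∧ 4 * Y = 3 * X - 4 ∧ -1 < X ∧ X < 0) ∨
  (u = .inr false ∧ v = .inr true ∧ X = 0 ∧ -1 < Y ∧ Y < 1)

/-- Eliminating the segment parameter turns intersection questions into arithmetic on `X`, `Y` and
the indices. -/
theorem WheelEdge.onWheelEdge {R : ℕ} (hR : 2 ≤ R) {u v : ℕ ⊕ Bool} (h : WheelEdge R u v)
    {x : ℝ × ℝ} (hx : x ∈ openSegment ℝ (wheelPos u) (wheelPos v)) :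
    OnWheelEdge R u v x.1 x.2 := by
  obtain ⟨a, b, ha, hb, hab, rfl⟩ := hx
  obtain rfl : a = 1 - b := by linarith
  have hR' : (2 : ℝ) ≤ R := by exact_mod_cast hR
  unfold OnWheelEdge
  cases h with
  | rim i h1 h2 =>
    refine Or.inl ⟨i, h1, h2, rfl, rfl, ?_⟩
    rw [wheelPos_inl h1, wheelPos_inl (by omega)]
    simp
    constructor <;> nlinarith
  | first =>
    refine Or.inr (Or.inl ⟨rfl, rfl, ?_⟩)
    simp [wheelPos]
    refine ⟨?_, ?_, ?_⟩ <;> linarith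
  | last =>
    refine Or.inr (Or.inr (Or.inl ⟨rfl, rfl, ?_⟩))
    rw [wheelPos_inl (by omega : 1 ≤ R)]
    simp [wheelPos]
    refine ⟨?_, ?_, ?_⟩ <;> nlinarith
  | spokeFalse i h1 h2 =>
    refine Or.inr (Or.inr (Or.inr (Or.inl ⟨i, h1, h2, rfl, rfl, ?_⟩)))
    rw [wheelPos_inl h1]
    simp [wheelPos]
    refine ⟨?_, ?_, ?_⟩ <;> nlinarith
  | spokeTrue i h1 h2 =>
    refine Or.inr (Or.inr (Or.inr (Or.inr (Or.inl ⟨i, h1, h2, rfl, rfl, ?_⟩))))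
    rw [wheelPos_inl h1]
    simp [wheelPos]
    refine ⟨?_, ?_, ?_⟩ <;> nlinarith
  | zeroFalse =>
    refine Or.inr (Or.inr (Or.inr (Or.inr (Or.inr (Or.inl ⟨rfl, rfl, ?_⟩)))))
    simp [wheelPos]
    refine ⟨?_, ?_, ?_⟩ <;> linarith
  | zeroTrue =>
    refine Or.inr (Or.inr (Or.inr (Or.inr (Or.inr (Or.inr (Or.inl ⟨rfl, rfl, ?_⟩))))))
    simp [wheelPos]
    refine ⟨?_, ?_, ?_⟩ <;> linarith
  | mid =>
    refine Or.inr (Or.inr (Or.inr (Or.inr (Or.inr (Or.inr (Or.inr ⟨rfl, rfl, ?_⟩))))))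
    simp [wheelPos]
    refine ⟨?_, ?_⟩ <;> linarith

theorem OnWheelEdge.not_wheelPos {R : ℕ} (hR : 2 ≤ R) {u v w : ℕ ⊕ Bool} {X Y : ℝ}
    (h : OnWheelEdge R u v X Y) (hw : wheelPos w = (X, Y)) : False := by
  have hR' : (2 : ℝ) ≤ R := by exact_mod_cast hR
  rcases w with (_ | j) | (_ | _) <;> simp only [wheelPos, Prod.mk.injEq] at hw <;>
    obtain ⟨rfl, rfl⟩ := hw <;>
    rcases h with ⟨i, h1, h2, -, -, h3, h4, h5⟩ | ⟨-, -, h3, h4, h5⟩ | ⟨-, -, h3, h4, h5⟩ |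
      ⟨i, h1, h2, -, -, h3, h4, h5⟩ | ⟨i, h1, h2, -, -, h3, h4, h5⟩ | ⟨-, -, h3, h4, h5⟩ |
      ⟨-, -, h3, h4, h5⟩ | ⟨-, -, h3, h4, h5⟩ <;> try linarith
  -- A rim vertex on a horizontal rim edge: an integer strictly between `i` and `i + 1`.
  · norm_cast at h4 h5
    omega

theorem OnWheelEdge.unique {R : ℕ} (hR : 2 ≤ R) {u v u' v' : ℕ ⊕ Bool} {X Y : ℝ}
    (h : OnWheelEdge R u v X Y) (h' : OnWheelEdge R u' v' X Y) :
    (u = u' ∧ v = v') ∨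
    (u = .inl 0 ∧ v = .inl 1 ∧ u' = .inr false ∧ v' = .inr true) ∨
    (u' = .inl 0 ∧ v' = .inl 1 ∧ u = .inr false ∧ v = .inr true) := by
  have hR' : (2 : ℝ) ≤ R := by exact_mod_cast hR
  rcases h with ⟨i, h1, h2, rfl, rfl, h3, h4, h5⟩ | ⟨rfl, rfl, h3, h4, h5⟩ |
      ⟨rfl, rfl, h3, h4, h5⟩ |
      ⟨i, h1, h2, rfl, rfl, h3, h4, h5⟩ | ⟨i, h1, h2, rfl, rfl, h3, h4, h5⟩ | ⟨rfl, rfl, h3, h4, h5⟩ |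
      ⟨rfl, rfl, h3, h4, h5⟩ | ⟨rfl, rfl, h3, h4, h5⟩ <;>
  rcases h' with ⟨j, k1, k2, rfl, rfl, k3, k4, k5⟩ | ⟨rfl, rfl, k3, k4, k5⟩ |
      ⟨rfl, rfl, k3, k4, k5⟩ |
      ⟨j, k1, k2, rfl, rfl, k3, k4, k5⟩ | ⟨j, k1, k2, rfl, rfl, k3, k4, k5⟩ | ⟨rfl, rfl, k3, k4, k5⟩ |
      ⟨rfl, rfl, k3, k4, k5⟩ | ⟨rfl, rfl, k3, k4, k5⟩ <;>
  first
  | exact Or.inl ⟨rfl, rfl⟩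
  | exact Or.inr (Or.inl ⟨rfl, rfl, rfl, rfl⟩)
  | exact Or.inr (Or.inr ⟨rfl, rfl, rfl, rfl⟩)
  | (exfalso; linarith)
  | (exfalso; have : (1 : ℝ) ≤ i := by exact_mod_cast h1
     have : (i : ℝ) ≤ R := by exact_mod_cast h2
     nlinarith)
  | (exfalso; have : (1 : ℝ) ≤ j := by exact_mod_cast k1
     have : (j : ℝ) ≤ R := by exact_mod_cast k2
     nlinarith)
  | (exfalso; nlinarith)
  | skip
  -- What remains is two edges of one indexed family: horizontal rim edges, then spokes to one
  -- middle vertex. A common interior point forces equal indices.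
  · have h6 : i < j + 1 := by exact_mod_cast h4.trans k5
    have h7 : j < i + 1 := by exact_mod_cast k4.trans h5
    obtain rfl : i = j := by omega
    exact Or.inl ⟨rfl, rfl⟩
  · have hij : (i : ℝ) = j := mul_right_cancel₀ (by linarith) (h3.symm.trans k3)
    obtain rfl : i = j := by exact_mod_cast hij
    exact Or.inl ⟨rfl, rfl⟩
  · have hij : (i : ℝ) = j := mul_right_cancel₀ (by linarith) (h3.symm.trans k3)
    obtain rfl : i = j := by exact_mod_cast hij
    exact Or.inl ⟨rfl, rfl⟩

/-- A graph whose vertices are labelled by those of a bicycle wheel, such that the edge between `0`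
and `1` and the edge between the middle vertices are not both present, is planar. -/
theorem isPlanar_of_wheelEdge {V : Type*} {G : SimpleGraph V} {R : ℕ} (hR : 2 ≤ R)
    (f : V → ℕ ⊕ Bool) (hf : Function.Injective f)
    (hadj : ∀ u v, G.Adj u v → WheelEdge R (f u) (f v) ∨ WheelEdge R (f v) (f u))
    (hmiss : ∀ u v u' v', G.Adj u v → G.Adj u' v' →
      ¬ (f u = .inl 0 ∧ f v = .inl 1 ∧ f u' = .inr false ∧ f v' = .inr true)) : G.IsPlanar := by
  have key : ∀ u v, G.Adj u v → ∀ x ∈ openSegment ℝ (wheelPos (f u)) (wheelPos (f v)),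
      ∃ u' v', G.Adj u' v' ∧ s(u, v) = s(u', v') ∧ OnWheelEdge R (f u') (f v') x.1 x.2 := by
    intro u v huv x hx
    rcases hadj u v huv with h | h
    · exact ⟨u, v, huv, rfl, h.onWheelEdge hR hx⟩
    · exact ⟨v, u, huv.symm, Sym2.eq_swap, h.onWheelEdge hR (by rwa [openSegment_symm])⟩
  refine isPlanar_of_openSegment (wheelPos ∘ f) (wheelPos_injective.comp hf) ?_ ?_
  · intro u v w huv hw
    obtain ⟨u', v', -, -, h⟩ := key u v huv _ hw
    exact h.not_wheelPos hR (w := f w) rfl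
  · intro u v u' v' huv huv' x hx hx'
    obtain ⟨a, b, hab, h1, h⟩ := key u v huv x hx
    obtain ⟨a', b', hab', h1', h'⟩ := key u' v' huv' x hx'
    rw [h1, h1']
    rcases h.unique hR h' with ⟨h2, h3⟩ | h2 | h2
    · rw [hf h2, hf h3]
    · exact absurd h2 (hmiss a b a' b' hab hab')
    · exact absurd h2 (hmiss a' b' a b hab' hab)

theorem wheelEdge_spoke {R i : ℕ} (hi : i ≤ R) (b : Bool) :
    WheelEdge R (.inl i) (.inr b) := by
  rcases Nat.eq_zero_or_pos i with rfl | h <;> cases b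
  · exact .zeroFalse
  · exact .zeroTrue
  · exact .spokeFalse i h hi
  · exact .spokeTrue i h hi

theorem wheelEdge_rim {R : ℕ} (hR : 2 ≤ R) (a : ZMod (R + 1)) :
    WheelEdge R (.inl a.val) (.inl (a + 1).val) ∨ WheelEdge R (.inl (a + 1).val) (.inl a.val) := by
  have hlt := ZMod.val_lt a
  have hone : (1 : ZMod (R + 1)).val = 1 := by
    rw [ZMod.val_one_eq_one_mod, Nat.mod_eq_of_lt (by omega)]
  rcases (Nat.lt_succ_iff.1 hlt).lt_or_eq with h | h
  · left
    rw [ZMod.val_add_of_lt (by omega), hone]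
    rcases Nat.eq_zero_or_pos a.val with h0 | h0
    · rw [h0]
      exact .first
    · exact .rim _ h0 h
  · right
    rw [ZMod.val_add_of_le (by omega), hone, h, Nat.sub_self]
    exact .last

/-- A spanning subgraph of a bicycle wheel that misses a rim edge or the edge between the middle
vertices is planar. -/
theorem isPlanar_of_not_adj {V : Type*} {G : SimpleGraph V} {R : ℕ} (hR : 2 ≤ R)
    (e : V ≃ ZMod (R + 1) ⊕ Bool)
    (hrim : ∀ x y, G.Adj (e.symm (.inl x)) (e.symm (.inl y)) → y = x + 1 ∨ x = y + 1)
    (k : ZMod (R + 1))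
    (hk : ¬ (G.Adj (e.symm (.inl k)) (e.symm (.inl (k + 1))) ∧
      G.Adj (e.symm (.inr false)) (e.symm (.inr true)))) : G.IsPlanar := by
  have hone : (1 : ZMod (R + 1)).val = 1 := by
    rw [ZMod.val_one_eq_one_mod, Nat.mod_eq_of_lt (by omega)]
  have hinj : Function.Injective fun x : ZMod (R + 1) => (x - k).val :=
    (ZMod.val_injective _).comp (sub_left_injective)
  have hval : ∀ x : ZMod (R + 1), (x - k).val ≤ R := fun x => Nat.lt_succ_iff.1 (ZMod.val_lt _)
  have hstep : ∀ x : ZMod (R + 1),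
      WheelEdge R (.inl (x - k).val) (.inl (x + 1 - k).val) ∨
      WheelEdge R (.inl (x + 1 - k).val) (.inl (x - k).val) := by
    intro x
    rw [add_sub_right_comm]
    exact wheelEdge_rim hR _
  -- Rotating by `k` carries the rim edge at `k` to the edge `0`, `1` that crosses the middle edge.
  refine isPlanar_of_wheelEdge hR (fun v => Sum.map (fun x => (x - k).val) id (e v))
    ((hinj.sumMap Function.injective_id).comp e.injective) ?_ ?_
  · intro u v huv
    obtain ⟨a, rfl⟩ := e.symm.surjective u
    obtain ⟨b, rfl⟩ := e.symm.surjective v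
    simp only [Equiv.apply_symm_apply]
    rcases a with x | a <;> rcases b with y | b
    · rcases hrim x y huv with rfl | rfl
      · exact hstep x
      · exact (hstep y).symm
    · exact Or.inl (wheelEdge_spoke (hval x) b)
    · exact Or.inr (wheelEdge_spoke (hval y) a)
    · cases a <;> cases b
      · exact absurd huv (G.irrefl)
      · exact Or.inl .mid
      · exact Or.inr .mid
      · exact absurd huv (G.irrefl)
  · intro u v u' v' huv huv' h
    obtain ⟨a, rfl⟩ := e.symm.surjective u
    obtain ⟨b, rfl⟩ := e.symm.surjective v
    obtain ⟨a', rfl⟩ := e.symm.surjective u'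
    obtain ⟨b', rfl⟩ := e.symm.surjective v'
    simp only [Equiv.apply_symm_apply] at h
    obtain ⟨h1, h2, h3, h4⟩ := h
    rcases a with x | a <;> rcases b with y | b <;> rcases a' with x' | a' <;>
      rcases b' with y' | b' <;>
      simp only [Sum.map_inl, Sum.map_inr, reduceCtorEq, Sum.inl.injEq, Sum.inr.injEq, id] at h1 h2 h3 h4
    subst h3 h4
    have hx : x = k := hinj (by simp [h1])
    have hy : y = k + 1 := hinj (by simp [h2, hone])
    subst hx hy
    exact hk ⟨huv, huv'⟩


/-! ### Cycles from rim paths and spokes -/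

/-- In a `3`-connected graph no vertex has all its neighbours in a set of at most two vertices. -/
theorem IsKConnected.exists_adj_notMem {V : Type*} {G : SimpleGraph V} {k : ℕ}
    (hG : G.IsKConnected k) (v : V) (S : Finset V) (hS : S.card < k) (hv : v ∉ S) :
    ∃ w, G.Adj v w ∧ w ∉ S := by
  have hcut := hG.2 S hS
  simp only [IsVertexCut, not_or, not_not] at hcut
  obtain ⟨hconn, hsub⟩ := hcut
  obtain ⟨w, hw, hwv⟩ : ∃ w ∈ ((S : Set V)ᶜ), w ≠ v := by
    by_contra! h
    exact hsub fun a ha b hb => (h a ha).trans (h b hb).symm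
  obtain ⟨p⟩ := hconn ⟨v, by simpa using hv⟩ ⟨w, hw⟩
  cases p with
  | nil => exact absurd rfl hwv
  | @cons _ y _ h _ => exact ⟨y, h, y.2⟩

/-- A closed sequence of `k ≥ 3` distinct vertices, consecutive ones adjacent, gives a cycle. -/
theorem exists_isCycle_of_injOn {V : Type*} {G : SimpleGraph V} {k : ℕ} (hk : 3 ≤ k) (f : ℕ → V)
    (hf : ∀ i < k, ∀ j < k, f i = f j → i = j) (hadj : ∀ i, i + 1 < k → G.Adj (f i) (f (i + 1)))
    (hlast : G.Adj (f (k - 1)) (f 0)) :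
    ∃ (v : V) (p : G.Walk v v), p.IsCycle ∧ p.length = k := by
  rw [← cycleGraph_isContained_iff (by omega)]
  have hstep : ∀ a b : Fin k, (b - a).val = 1 → G.Adj (f a) (f b) := by
    intro a b h
    rw [Fin.val_sub] at h
    have ha := a.2
    have hb := b.2
    rcases le_or_gt a.val b.val with hab | hab
    · have : k - a.val + b.val = b.val - a.val + k := by omega
      rw [this, Nat.add_mod_right, Nat.mod_eq_of_lt (by omega)] at h
      have h' : b.val = a.val + 1 := by omega
      rw [h']
      exact hadj _ (by omega)
    · rw [Nat.mod_eq_of_lt (by omega)] at h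
      have h1 : b.val = 0 := by omega
      have h2 : a.val = k - 1 := by omega
      rw [h1, h2]
      exact hlast
  refine ⟨⟨⟨fun i => f i, ?_⟩, fun i j h => Fin.ext (hf _ i.2 _ j.2 h)⟩⟩
  intro a b h
  rcases cycleGraph_adj'.1 h with h | h
  · exact (hstep b a h).symm
  · exact hstep a b h


theorem natCast_add_left_inj_of_lt {r : ℕ} {x : ZMod r} {i j : ℕ} (hi : i < r) (hj : j < r)
    (h : x + i = x + j) : i = j := by
  have := congrArg ZMod.val (add_left_cancel h)
  rwa [ZMod.val_natCast_of_lt hi, ZMod.val_natCast_of_lt hj] at this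

/-- A cycle through a rim path with `a` edges and one middle vertex. -/
theorem exists_isCycle_of_spokes_same {V : Type*} {G : SimpleGraph V} {r : ℕ}
    (e : V ≃ ZMod r ⊕ Bool)
    (hrim : ∀ x, G.Adj (e.symm (.inl x)) (e.symm (.inl (x + 1))))
    {x : ZMod r} {b : Bool} {a : ℕ} (ha : 1 ≤ a) (har : a < r)
    (h1 : G.Adj (e.symm (.inl x)) (e.symm (.inr b)))
    (h2 : G.Adj (e.symm (.inl (x + a))) (e.symm (.inr b))) :
    ∃ (v : V) (p : G.Walk v v), p.IsCycle ∧ p.length = a + 2 := by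
  refine exists_isCycle_of_injOn (by omega)
    (fun i => e.symm (if i ≤ a then .inl (x + i) else .inr b)) ?_ ?_ ?_
  · intro i hi j hj h
    have h := e.symm.injective h
    split_ifs at h with hi' hj' hj'
    · exact natCast_add_left_inj_of_lt (by omega) (by omega) (Sum.inl_injective h)
    · omega
  · intro i hi
    rcases (show i ≤ a by omega).lt_or_eq with h | rfl
    · simp only [if_pos h.le, if_pos (show i + 1 ≤ a by omega), Nat.cast_add, Nat.cast_one,
        ← add_assoc]
      exact hrim _
    · simpa using h2
  · simpa using h1.symm

/-- A cycle through a rim path with `d` edges and both middle vertices. -/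
theorem exists_isCycle_of_spokes_ne {V : Type*} {G : SimpleGraph V} {r : ℕ}
    (e : V ≃ ZMod r ⊕ Bool)
    (hrim : ∀ x, G.Adj (e.symm (.inl x)) (e.symm (.inl (x + 1))))
    (hmid : G.Adj (e.symm (.inr false)) (e.symm (.inr true)))
    {x : ZMod r} {b : Bool} {d : ℕ} (hd : d < r)
    (h1 : G.Adj (e.symm (.inl x)) (e.symm (.inr b)))
    (h2 : G.Adj (e.symm (.inl (x + d))) (e.symm (.inr !b))) :
    ∃ (v : V) (p : G.Walk v v), p.IsCycle ∧ p.length = d + 3 := by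
  have hmid' : G.Adj (e.symm (.inr !b)) (e.symm (.inr b)) := by
    cases b
    · exact hmid.symm
    · exact hmid
  refine exists_isCycle_of_injOn (by omega)
    (fun i => e.symm (if i ≤ d then .inl (x + i) else if i = d + 1 then .inr !b else .inr b))
    ?_ ?_ ?_
  · intro i hi j hj h
    have h := e.symm.injective h
    split_ifs at h
    · exact natCast_add_left_inj_of_lt (by omega) (by omega) (Sum.inl_injective h)
    · omega
    · simp at h
    · simp at h
    · omega
  · intro i hi
    rcases (show i ≤ d + 1 by omega).lt_or_eq with h | rfl
    · rcases (show i ≤ d by omega).lt_or_eq with h | rfl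
      · simp only [if_pos h.le, if_pos (show i + 1 ≤ d by omega), Nat.cast_add, Nat.cast_one,
          ← add_assoc]
        exact hrim _
      · simpa using h2
    · simpa using hmid'
  · simpa using h1.symm

/-- Either there is a cycle of length `d + 3`, or the types of the spokes alternate. -/
theorem exists_isCycle_or_alternating {V : Type*} {G : SimpleGraph V} {r : ℕ}
    (e : V ≃ ZMod r ⊕ Bool)
    (hrim : ∀ x, G.Adj (e.symm (.inl x)) (e.symm (.inl (x + 1))))
    (hmid : G.Adj (e.symm (.inr false)) (e.symm (.inr true)))
    (hcover : ∀ x, ∃ b, G.Adj (e.symm (.inl x)) (e.symm (.inr b)))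
    (hspoke : ∀ b, ∃ x, G.Adj (e.symm (.inl x)) (e.symm (.inr b)))
    {d : ℕ} (hd : d < r) :
    (∃ (v : V) (p : G.Walk v v), p.IsCycle ∧ p.length = d + 3) ∨
    ∀ x b, (G.Adj (e.symm (.inl (x + 1))) (e.symm (.inr b)) ↔
        ¬ G.Adj (e.symm (.inl x)) (e.symm (.inr b))) ∧
      (G.Adj (e.symm (.inl x)) (e.symm (.inr !b)) ↔
        ¬ G.Adj (e.symm (.inl x)) (e.symm (.inr b))) := by
  refine or_iff_not_imp_left.2 fun hno => ?_
  have : NeZero r := ⟨by omega⟩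
  set s : ZMod r → Bool → Prop := fun x b => G.Adj (e.symm (.inl x)) (e.symm (.inr b)) with hs
  have hne : ∀ x b, s x b → ¬ s (x + d) (!b) := fun x b h1 h2 =>
    hno (exists_isCycle_of_spokes_ne e hrim hmid hd h1 h2)
  have hcover' : ∀ x b, ¬ s x b → s x (!b) := by
    intro x b h
    obtain ⟨b', hb'⟩ := hcover x
    rcases Bool.eq_or_eq_not b' b with rfl | rfl
    · exact absurd hb' h
    · exact hb'
  -- Each rim vertex has a spoke, so lacking one type means having the other; `hne` then works in
  -- both directions.
  have hshift : ∀ x b, s (x + d) b ↔ s x b := by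
    intro x b
    constructor
    · intro h
      by_contra h'
      have := hne x _ (hcover' x b h')
      rw [Bool.not_not] at this
      exact this h
    · intro h
      have := hcover' _ _ (hne x b h)
      rwa [Bool.not_not] at this
  have hsame : ∀ x b, s x b → ¬ s (x + 1) b := by
    rcases (show d + 1 ≤ r by omega).lt_or_eq with h | h
    · intro x b h1 h2
      refine hno (exists_isCycle_of_spokes_same e hrim (by omega) h h1 ?_)
      have := (hshift (x + 1) b).2 h2
      rwa [Nat.cast_add, Nat.cast_one, add_comm (d : ZMod r), ← add_assoc]
    -- A path of `d + 1 = r` edges would close up on the rim. Here instead `d = -1` in `ZMod r`, so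
    -- the types are constant around the rim and every spoke is present, against `hne`.
    · exfalso
      have hd1 : (d : ZMod r) = -1 := by
        rw [eq_neg_iff_add_eq_zero, ← Nat.cast_one, ← Nat.cast_add, h, ZMod.natCast_self]
      have hstep : ∀ x b, s x b → s (x + 1) b := by
        intro x b hx
        refine (hshift _ _).1 ?_
        rwa [hd1, add_neg_cancel_right]
      have hmany : ∀ (n : ℕ) x b, s x b → s (x + n) b := by
        intro n
        induction n with
        | zero => simp
        | succ n ih =>
          intro x b hx
          rw [Nat.cast_succ, ← add_assoc]
          exact hstep _ _ (ih x b hx)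
      have hall : ∀ x b, s x b := by
        intro x b
        obtain ⟨y, hy⟩ := hspoke b
        have := hmany (x - y).val y b hy
        rwa [ZMod.natCast_zmod_val, add_sub_cancel] at this
      exact hne 0 true (hall _ _) (hall _ _)
  have hsame' : ∀ x b, ¬ s x b → s (x + 1) b := by
    intro x b h
    have := hcover' _ _ (hsame x _ (hcover' x b h))
    rwa [Bool.not_not] at this
  -- Both types at `x` would leave `x + 1` without a spoke.
  refine fun x b => ⟨⟨fun h h' => hsame x b h' h, hsame' x b⟩, fun h h' => ?_, hcover' x b⟩
  exact hsame x _ h (hcover' _ _ (hsame x b h'))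


/-! ### Recognising `A_n` -/

theorem cycleGraph_adj_zmod {R : ℕ} (hR : 1 ≤ R) (x y : ZMod (R + 1)) :
    (cycleGraph (R + 1)).Adj x y ↔ y = x + 1 ∨ x = y + 1 := by
  obtain ⟨k, rfl⟩ := Nat.exists_eq_add_of_le' hR
  have h : (cycleGraph (k + 1 + 1)).Adj x y ↔ x - y = 1 ∨ y - x = 1 := Iff.rfl
  rw [h, sub_eq_iff_eq_add', sub_eq_iff_eq_add', or_comm]

theorem alternatingBicycleWheel_adj_inl_inl {n : ℕ} (x y : Fin (n - 2)) :
    (alternatingBicycleWheel n).Adj (.inl x) (.inl y) ↔ (cycleGraph (n - 2)).Adj x y := by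
  simp [alternatingBicycleWheel, deleteEdges_adj, alternatingMissingSpokes, bicycleWheel,
    bicycleWheelAdj]

/-- Labels start at 1 and indices at 0, so the parity is reversed. -/
theorem alternatingBicycleWheel_adj_inl_inr {n : ℕ} (x : Fin (n - 2)) (b : Bool) :
    (alternatingBicycleWheel n).Adj (.inl x) (.inr b) ↔ (Even x.val ↔ b = false) := by
  cases b <;> simp [alternatingBicycleWheel, deleteEdges_adj, alternatingMissingSpokes,
    bicycleWheel, bicycleWheelAdj, Nat.even_add_one, Nat.odd_add_one]

theorem alternatingBicycleWheel_adj_inr_inr {n : ℕ} (a b : Bool) :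
    (alternatingBicycleWheel n).Adj (.inr a) (.inr b) ↔ a ≠ b := by
  simp [alternatingBicycleWheel, deleteEdges_adj, alternatingMissingSpokes, bicycleWheel,
    bicycleWheelAdj]

/-- If the types of the spokes alternate around the rim, the graph is `A_n`. -/
theorem even_and_nonempty_iso_alternatingBicycleWheel {V : Type*} {G : SimpleGraph V} {R : ℕ}
    (hR : 2 ≤ R) (e : V ≃ ZMod (R + 1) ⊕ Bool)
    (hrim : ∀ x y, G.Adj (e.symm (.inl x)) (e.symm (.inl y)) ↔ y = x + 1 ∨ x = y + 1)
    (hmid : G.Adj (e.symm (.inr false)) (e.symm (.inr true)))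
    (halt : ∀ x b, (G.Adj (e.symm (.inl (x + 1))) (e.symm (.inr b)) ↔
        ¬ G.Adj (e.symm (.inl x)) (e.symm (.inr b))) ∧
      (G.Adj (e.symm (.inl x)) (e.symm (.inr !b)) ↔
        ¬ G.Adj (e.symm (.inl x)) (e.symm (.inr b)))) :
    Even (R + 3) ∧ Nonempty (G ≃g alternatingBicycleWheel (R + 3)) := by
  obtain ⟨b₀, hb₀⟩ : ∃ b, G.Adj (e.symm (.inl 0)) (e.symm (.inr b)) := by
    by_contra! h
    exact h _ ((halt 0 true).2.2 (h true))
  have hnat : ∀ (n : ℕ) (b : Bool),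
      G.Adj (e.symm (.inl (n : ZMod (R + 1)))) (e.symm (.inr b)) ↔ (Even n ↔ b = b₀) := by
    intro n
    induction n with
    | zero =>
      intro b
      rw [Nat.cast_zero]
      rcases Bool.eq_or_eq_not b b₀ with rfl | rfl
      · simp [hb₀]
      · simp [(halt 0 b₀).2, hb₀]
    | succ n ih =>
      intro b
      rw [Nat.cast_succ, (halt _ b).1, ih, Nat.even_add_one]
      tauto
  -- One full turn returns to `0`.
  have heven : Even (R + 1) := by
    have h := hnat (R + 1) b₀
    rw [ZMod.natCast_self] at h
    simpa using h.1 hb₀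
  have hs : ∀ (x : ZMod (R + 1)) (b : Bool),
      G.Adj (e.symm (.inl x)) (e.symm (.inr b)) ↔ (Even x.val ↔ b = b₀) := by
    intro x b
    rw [← hnat, ZMod.natCast_zmod_val]
  -- In `A_n` index 0 carries the `false` spoke, so the middle vertices are swapped when `b₀ =
  -- true`.
  let σ : Bool ≃ Bool := ⟨fun b => b ^^ b₀, fun b => b ^^ b₀, fun b => by simp, fun b => by simp⟩
  have hσ : ∀ b, σ b = false ↔ b = b₀ := fun b => by simp [σ]
  let τ : ZMod (R + 1) ≃ Fin (R + 3 - 2) := Equiv.refl (Fin (R + 1))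
  refine ⟨by simpa [Nat.even_add, parity_simps] using heven,
    ⟨e.trans (τ.sumCongr σ), ?_⟩⟩
  have hspoke : ∀ (x : ZMod (R + 1)) (b : Bool),
      (alternatingBicycleWheel (R + 3)).Adj (.inl (τ x)) (.inr (σ b)) ↔
        G.Adj (e.symm (.inl x)) (e.symm (.inr b)) := by
    intro x b
    rw [alternatingBicycleWheel_adj_inl_inr, hs, hσ]
    exact Iff.rfl
  intro u v
  obtain ⟨a, rfl⟩ := e.symm.surjective u
  obtain ⟨b, rfl⟩ := e.symm.surjective v
  simp only [Equiv.trans_apply, Equiv.apply_symm_apply, Equiv.sumCongr_apply]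
  rcases a with x | a <;> rcases b with y | b
  · rw [hrim, ← cycleGraph_adj_zmod (by omega)]
    exact alternatingBicycleWheel_adj_inl_inl _ _
  · exact hspoke x b
  · rw [adj_comm, G.adj_comm]
    exact hspoke y a
  · rw [Sum.map_inr, Sum.map_inr, alternatingBicycleWheel_adj_inr_inr, σ.injective.ne_iff]
    cases a <;> cases b <;> simp [hmid, hmid.symm]

/-- A `𝓑` graph is, in suitable coordinates, a bicycle wheel that only lacks some spokes, and each
of its vertices is incident to a spoke. -/
theorem IsBGraph.exists_coordinates {V : Type*} [Finite V] {G : SimpleGraph V} {R : ℕ}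
    (hR : 2 ≤ R) (hcard : Nat.card V = R + 3) (hG : G.IsBGraph) :
    ∃ e : V ≃ ZMod (R + 1) ⊕ Bool,
      (∀ x y, G.Adj (e.symm (.inl x)) (e.symm (.inl y)) ↔ y = x + 1 ∨ x = y + 1) ∧
      G.Adj (e.symm (.inr false)) (e.symm (.inr true)) ∧
      (∀ x, ∃ b, G.Adj (e.symm (.inl x)) (e.symm (.inr b))) ∧
      (∀ b, ∃ x, G.Adj (e.symm (.inl x)) (e.symm (.inr b))) := by
  classical
  obtain ⟨⟨m, hm, E, ⟨φ⟩⟩, hplanar, hconn⟩ := hG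
  obtain rfl : m = R + 3 := by
    have h := Nat.card_congr φ.toEquiv
    simp only [hcard, Nat.card_eq_fintype_card, Fintype.card_sum, Fintype.card_fin,
      Fintype.card_bool] at h
    omega
  let τ : Fin (R + 3 - 2) ≃ ZMod (R + 1) := Equiv.refl (Fin (R + 1))
  let e : V ≃ ZMod (R + 1) ⊕ Bool := φ.toEquiv.trans (τ.sumCongr (Equiv.refl Bool))
  have hle : ∀ x y, G.Adj (e.symm (.inl x)) (e.symm (.inl y)) → y = x + 1 ∨ x = y + 1 := by
    intro x y h
    have h' := (deleteEdges_adj.1 (φ.symm.map_adj_iff.1 h)).1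
    exact (cycleGraph_adj_zmod (by omega) x y).1 h'
  have hrim : ∀ k, G.Adj (e.symm (.inl k)) (e.symm (.inl (k + 1))) ∧
      G.Adj (e.symm (.inr false)) (e.symm (.inr true)) := fun k => by
    by_contra h
    exact hplanar (isPlanar_of_not_adj hR e hle k h)
  refine ⟨e, fun x y => ⟨hle x y, ?_⟩, (hrim 0).2, fun x => ?_, fun b => ?_⟩
  · rintro (rfl | rfl)
    · exact (hrim x).1
    · exact (hrim y).1.symm
  · have hone : (1 : ZMod (R + 1)) ≠ 0 := by
      have : Fact (1 < R + 1) := ⟨by omega⟩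
      exact one_ne_zero
    -- Only two neighbours can lie on the rim, so a third must be a middle vertex.
    obtain ⟨w, hw, hwS⟩ := hconn.exists_adj_notMem (e.symm (.inl x))
      {e.symm (.inl (x + 1)), e.symm (.inl (x - 1))} (Finset.card_le_two.trans_lt (by omega))
      (by simp [hone, eq_sub_iff_add_eq])
    obtain ⟨y | b, rfl⟩ := e.symm.surjective w
    · exfalso
      rcases hle x y hw with rfl | rfl <;> simp at hwS
    · exact ⟨b, hw⟩
  · obtain ⟨w, hw, hwS⟩ := hconn.exists_adj_notMem (e.symm (.inr b))
      {e.symm (.inr !b)} (by simp) (by simp)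
    obtain ⟨y | b', rfl⟩ := e.symm.surjective w
    · exact ⟨y, hw.symm⟩
    · exfalso
      rcases Bool.eq_or_eq_not b' b with rfl | rfl
      · exact G.irrefl hw
      · simp at hwS

end SimpleGraph

theorem mainTheorem4 {V : Type*} [Finite V] (G : SimpleGraph V) (n : ℕ) (hn : 5 ≤ n)
    (hcard : Nat.card V = n) (hG : G.IsBGraph)
    (hA : ¬ (Even n ∧ Nonempty (G ≃g SimpleGraph.alternatingBicycleWheel n))) :
    G.IsPancyclic := by
  obtain ⟨R, rfl⟩ := Nat.exists_eq_add_of_le' (show 3 ≤ n by omega)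
  obtain ⟨e, hrim, hmid, hcover, hspoke⟩ := hG.exists_coordinates (by omega) hcard
  intro k hk3 hkn
  obtain ⟨d, rfl⟩ := Nat.exists_eq_add_of_le' hk3
  rcases SimpleGraph.exists_isCycle_or_alternating e (fun x => (hrim _ _).2 (Or.inl rfl)) hmid
    hcover hspoke (show d < R + 1 by omega) with h | h
  · exact h
  · exact absurd (SimpleGraph.even_and_nonempty_iso_alternatingBicycleWheel (by omega) e hrim hmid
      h) hA
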